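/- Let $p$ be a prime and let $G$ be the dihedral group $D_{2p}$ or $D_{2p^2}$, where $D_{2n}=\langle a,b : a^n=b^2=1,\ bab=a^{-1}\rangle$ is the dihedral group of order $2n$ (for $n=2$ this is the Klein four-group). Let $\mathcal{B}(G)$ be the bipartite graph whose vertex set is the disjoint union of $G\times G$ and the set of all subgroups of $G$, in which the only edges join $(a,b)\in G\times G$ to the subgroup $H=\langle a,b\rangle$ generated by $a$ and $b$. For a finite simple graph $\Gamma$ with $N$ vertices, $m$ edges, adjacency matrix $A$ and diagonal degree matrix $D$, put $$E(\Gamma)=\sum_{\alpha}|\alpha|,\qquad LE(\Gamma)=\sum_{\lambda}\left|\lambda-\frac{2m}{N}\right|,\qquad LE^{+}(\Gamma)=\sum_{\mu}\left|\mu-\frac{2m}{N}\right|,$$ where $\alpha$, $\lambda$, $\mu$ run over the eigenvalues, with multiplicity, of $A$, $D-A$ and $D+A$ respectively. Then $$E(\mathcal{B}(G))<LE(\mathcal{B}(G))=LE^{+}(\mathcal{B}(G)),$$ and moreover $E(\mathcal{B}(G))<|V(\mathcal{B}(G))|<LE(\mathcal{B}(G))$. -/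

import Mathlib

namespace SGB

section Energies

variable {V : Type*} [Fintype V] [DecidableEq V] (Γ : SimpleGraph V) [DecidableRel Γ.Adj]

/-- The signless Laplacian matrix `Q = D + A` of a finite simple graph. -/
def signlessLapMatrix : Matrix V V ℝ := Γ.degMatrix ℝ + Γ.adjMatrix ℝ

/-- The spectrum of `Γ`: the multiset of eigenvalues of the adjacency matrix. The matrix is real
symmetric, so all its eigenvalues are real and the multiset of roots of the characteristic
polynomial lists each of them with its multiplicity. -/
noncomputable def spec : Multiset ℝ := (Γ.adjMatrix ℝ).charpoly.roots

/-- The Laplacian spectrum: the multiset of eigenvalues of `D - A`. -/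
noncomputable def lapSpec : Multiset ℝ := (Γ.lapMatrix ℝ).charpoly.roots

/-- The signless Laplacian spectrum: the multiset of eigenvalues of `D + A`. -/
noncomputable def signlessLapSpec : Multiset ℝ := (signlessLapMatrix Γ).charpoly.roots

/-- The average degree `2m/n` of a graph with `n` vertices and `m` edges. -/
noncomputable def averageDegree : ℝ := 2 * (Γ.edgeFinset.card : ℝ) / (Fintype.card V : ℝ)

/-- The energy `E(Γ)`. -/
noncomputable def energy : ℝ := ((spec Γ).map fun x => |x|).sum

/-- The Laplacian energy `LE(Γ)`. -/
noncomputable def lapEnergy : ℝ := ((lapSpec Γ).map fun x => |x - averageDegree Γ|).sum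

/-- The signless Laplacian energy `LE⁺(Γ)`. -/
noncomputable def signlessLapEnergy : ℝ :=
  ((signlessLapSpec Γ).map fun x => |x - averageDegree Γ|).sum

end Energies

/-- The vertex set of the subgroup generating bipartite graph: the disjoint union of `G × G`
and the set of all subgroups of `G`. -/
abbrev Vertex (G : Type*) [Group G] : Type _ := (G × G) ⊕ Subgroup G

/-- The subgroup generating bipartite graph of `G`: the only edges join a pair `(a, b)` with the
subgroup generated by `a` and `b`. -/
def sgbGraph (G : Type*) [Group G] : SimpleGraph (Vertex G) where
  Adj
    | Sum.inl x, Sum.inr H => Subgroup.closure {x.1, x.2} = H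
    | Sum.inr H, Sum.inl x => Subgroup.closure {x.1, x.2} = H
    | Sum.inl _, Sum.inl _ => False
    | Sum.inr _, Sum.inr _ => False
  symm := ⟨by rintro (x | H) (y | K) h <;> exact h⟩
  loopless := ⟨by rintro (x | H) h <;> exact h⟩

noncomputable instance (G : Type*) [Group G] [Finite G] : Fintype (Subgroup G) :=
  Fintype.ofFinite _

noncomputable instance (G : Type*) [Group G] : DecidableEq (Vertex G) := Classical.decEq _

noncomputable instance (G : Type*) [Group G] : DecidableRel (sgbGraph G).Adj :=
  Classical.decRel _

end SGB

/-! Each pair has degree one, so the graph is a disjoint union of stars, centred at the subgroups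
`H` with `d_H` leaves, the number of pairs generating `H`. Subgroups of a dihedral group are
2-generated, so every `d_H ≥ 1`. With `P` pairs, `S` subgroups and `N = P + S = ∑ (d_H + 1)`, the
adjacency eigenvalues are `±√d_H` and zeros, and those of `D + A` are `0`, `d_H + 1` and `P - S`
ones. Hence `E = ∑ 2√d_H < N` by AM-GM, and `LE⁺ = N + (P - S)² / N > N`, both strict because `S <
P`. Bipartiteness makes `D - A` and `D + A` similar. -/

namespace SGB

open Matrix Polynomial

/-! ### Spectra and energies of star forests -/

section StarForest

variable {P S : Type*} [Fintype P]

/-- The cardinality of the fibre of `f` over `s`. -/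
def fiberCard [DecidableEq S] (f : P → S) (s : S) : ℕ := (Finset.univ.filter fun x => f x = s).card

/-- The incidence matrix of the graph of a function. -/
def incidence [DecidableEq S] (f : P → S) : Matrix P S ℝ := Matrix.of fun x s => if f x = s then 1 else 0

lemma incidence_transpose_mul [DecidableEq S] (f : P → S) :
    (incidence f)ᵀ * incidence f = diagonal fun s => (fiberCard f s : ℝ) := by
  ext s t
  simp only [mul_apply, transpose_apply, incidence, of_apply, diagonal_apply, fiberCard]
  by_cases h : s = t
  · subst h
    simp [← ite_and]
  · rw [if_neg h]
    refine Finset.sum_eq_zero fun x _ => ?_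
    by_cases hx : f x = s
    · simp [hx, h]
    · simp [hx]

variable [Fintype S]

lemma sum_fiberCard [DecidableEq S] (f : P → S) : ∑ s, fiberCard f s = Fintype.card P :=
  (Finset.card_eq_sum_card_fiberwise (f := f) (s := Finset.univ) (t := Finset.univ)
    (fun _ _ => Finset.mem_coe.2 (Finset.mem_univ _))).symm

/-- Schur complement of the scalar block: it is diagonal because distinct fibres are disjoint. -/
lemma det_fromBlocks_incidence [DecidableEq P] [DecidableEq S] (f : P → S) {t : ℝ} (ht : t ≠ 0) (e : S → ℝ) :
    (fromBlocks (diagonal fun _ => t) (-incidence f) (-(incidence f)ᵀ) (diagonal e)).det =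
      t ^ Fintype.card P * ∏ s, (e s - fiberCard f s / t) := by
  have h1 : (diagonal fun _ : P => t) * (diagonal fun _ => t⁻¹) = 1 := by
    rw [diagonal_mul_diagonal]
    simp [ht]
  let _ : Invertible (diagonal fun _ : P => t) := invertibleOfRightInverse _ _ h1
  have h2 : ⅟(diagonal fun _ : P => t) = t⁻¹ • (1 : Matrix P P ℝ) := by
    rw [invOf_eq_right_inv h1, smul_one_eq_diagonal]
  rw [det_fromBlocks₁₁, h2]
  have h3 : diagonal e - -(incidence f)ᵀ * (t⁻¹ • (1 : Matrix P P ℝ)) * -incidence f =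
      diagonal fun s => e s - fiberCard f s / t := by
    simp only [Matrix.neg_mul, Matrix.mul_neg, Matrix.mul_smul, Matrix.mul_one,
      Matrix.smul_mul, incidence_transpose_mul]
    ext i j
    by_cases h : i = j
    · subst h
      simp [div_eq_inv_mul]
    · simp [h]
  rw [h3, det_diagonal, det_diagonal]
  simp

lemma pow_mul_prod_sub_div {t : ℝ} (ht : t ≠ 0) (hc : Fintype.card S ≤ Fintype.card P)
    (e d : S → ℝ) :
    t ^ Fintype.card P * ∏ s, (e s - d s / t) =
      t ^ (Fintype.card P - Fintype.card S) * ∏ s, (e s * t - d s) := by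
  have h : ∏ s, (e s * t - d s) = t ^ Fintype.card S * ∏ s, (e s - d s / t) := by
    rw [← Finset.card_univ (α := S), ← Finset.prod_const, ← Finset.prod_mul_distrib]
    refine Finset.prod_congr rfl fun s _ => ?_
    field_simp
  rw [h, ← mul_assoc, ← pow_add, Nat.sub_add_cancel hc]

/-- Lets characteristic polynomials be compared away from the one point where the scalar block is
singular. -/
lemma eq_of_eval_eq_of_ne {p q : ℝ[X]} (a : ℝ) (h : ∀ t, t ≠ a → p.eval t = q.eval t) :
    p = q :=
  eq_of_infinite_eval_eq p q <|
    (Set.Infinite.mono (s := {a}ᶜ) fun t ht => h t ht) (Set.finite_singleton a).infinite_compl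

lemma charpoly_adjacency [DecidableEq P] [DecidableEq S] (f : P → S)
    (hc : Fintype.card S ≤ Fintype.card P) :
    (fromBlocks 0 (incidence f) (incidence f)ᵀ 0).charpoly =
      (X - C 0) ^ (Fintype.card P - Fintype.card S) *
        ∏ s, ((X - C √(fiberCard f s)) * (X - C (-√(fiberCard f s)))) := by
  refine eq_of_eval_eq_of_ne 0 fun t ht => ?_
  have h : scalar (P ⊕ S) t - fromBlocks 0 (incidence f) (incidence f)ᵀ 0 =
      fromBlocks (diagonal fun _ => t) (-incidence f) (-(incidence f)ᵀ) (diagonal fun _ => t) := by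
    ext (i | i) (j | j) <;> simp [diagonal_apply]
  rw [eval_charpoly, h, det_fromBlocks_incidence f ht, pow_mul_prod_sub_div ht hc]
  simp only [eval_mul, eval_pow, eval_X, eval_prod, eval_sub, eval_C, sub_zero]
  congr 1
  refine Finset.prod_congr rfl fun s _ => ?_
  linear_combination (Real.sq_sqrt (Nat.cast_nonneg (α := ℝ) (fiberCard f s)))

lemma charpoly_signless [DecidableEq P] [DecidableEq S] (f : P → S)
    (hc : Fintype.card S ≤ Fintype.card P) :
    (fromBlocks 1 (incidence f) (incidence f)ᵀ
        (diagonal fun s => (fiberCard f s : ℝ))).charpoly =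
      (X - C 1) ^ (Fintype.card P - Fintype.card S) *
        ∏ s, ((X - C 0) * (X - C (fiberCard f s + 1 : ℝ))) := by
  refine eq_of_eval_eq_of_ne 1 fun t ht => ?_
  have h : scalar (P ⊕ S) t - fromBlocks 1 (incidence f) (incidence f)ᵀ
        (diagonal fun s => (fiberCard f s : ℝ)) =
      fromBlocks (diagonal fun _ => t - 1) (-incidence f) (-(incidence f)ᵀ)
        (diagonal fun s => t - fiberCard f s) := by
    ext (i | i) (j | j)
    · by_cases hij : i = j <;> simp [hij, one_apply]
    · simp
    · simp
    · by_cases hij : i = j <;> simp [hij]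
  have ht' : t - 1 ≠ 0 := sub_ne_zero.2 ht
  rw [eval_charpoly, h, det_fromBlocks_incidence f ht', pow_mul_prod_sub_div ht' hc]
  simp only [eval_mul, eval_pow, eval_X, eval_prod, eval_sub, eval_C]
  congr 1
  refine Finset.prod_congr rfl fun s _ => ?_
  ring

lemma sum_map_roots_pow_mul_prod (g : ℝ → ℝ) (k : ℕ) (a : ℝ) (u v : S → ℝ) :
    ((((X - C a) ^ k * ∏ s, ((X - C (u s)) * (X - C (v s)))).roots).map g).sum =
      k * g a + ∑ s, (g (u s) + g (v s)) := by
  have h1 : ((X - C a) ^ k : ℝ[X]) ≠ 0 := pow_ne_zero _ (X_sub_C_ne_zero a)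
  have h2 (s : S) : ((X - C (u s)) * (X - C (v s)) : ℝ[X]) ≠ 0 :=
    mul_ne_zero (X_sub_C_ne_zero _) (X_sub_C_ne_zero _)
  have h3 : (∏ s, ((X - C (u s)) * (X - C (v s))) : ℝ[X]) ≠ 0 :=
    Finset.prod_ne_zero_iff.2 fun s _ => h2 s
  rw [roots_mul (mul_ne_zero h1 h3), roots_pow, roots_X_sub_C, roots_prod _ _ h3,
    Multiset.map_add, Multiset.sum_add, Multiset.map_nsmul, Multiset.sum_nsmul,
    Multiset.map_bind, Multiset.sum_bind]
  simp only [roots_mul (h2 _), roots_X_sub_C, Multiset.map_add, Multiset.sum_add,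
    Multiset.map_singleton, Multiset.sum_singleton, nsmul_eq_mul]
  rfl

/-- Sum `2√d ≤ d + 1` over the fibres. Equality throughout would force all fibres to be singletons,
hence equal cardinalities. -/
lemma sum_two_sqrt_fiberCard_lt [DecidableEq S] (f : P → S)
    (hc : Fintype.card S < Fintype.card P) :
    ∑ s, 2 * √(fiberCard f s : ℝ) < Fintype.card P + Fintype.card S := by
  have hsum : ∑ s, ((fiberCard f s : ℝ) + 1) = Fintype.card P + Fintype.card S := by
    rw [Finset.sum_add_distrib, ← sum_fiberCard f]
    simp
  have key (s : S) : (√(fiberCard f s : ℝ) - 1) ^ 2 =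
      fiberCard f s + 1 - 2 * √(fiberCard f s : ℝ) := by
    linear_combination Real.sq_sqrt (Nat.cast_nonneg (α := ℝ) (fiberCard f s))
  rw [← hsum]
  refine Finset.sum_lt_sum (fun s _ => ?_) ?_
  · have := key s
    nlinarith [sq_nonneg (√(fiberCard f s : ℝ) - 1)]
  · by_contra! h
    have hone (s : S) : fiberCard f s = 1 := by
      have h1 : (√(fiberCard f s : ℝ) - 1) ^ 2 = 0 :=
        le_antisymm (by linarith [key s, h s (Finset.mem_univ s)]) (sq_nonneg _)
      have h2 : √(fiberCard f s : ℝ) = 1 := sub_eq_zero.1 (pow_eq_zero_iff two_ne_zero |>.1 h1)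
      exact_mod_cast Real.sqrt_eq_one.1 h2
    have := sum_fiberCard f
    simp only [hone, Finset.sum_const, Finset.card_univ, smul_eq_mul, mul_one] at this
    omega

/-- The signless Laplacian energy of a star forest, for the mean degree `c`. -/
lemma signless_sum_eq [DecidableEq S] (f : P → S) (hf : Function.Surjective f) {c N : ℝ}
    (hN : N = Fintype.card P + Fintype.card S) (hN0 : 0 < N) (hc : c = 2 * Fintype.card P / N) :
    ((Fintype.card P - Fintype.card S : ℕ) : ℝ) * |1 - c| +
        ∑ s, (|0 - c| + |(fiberCard f s + 1 : ℝ) - c|) =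
      N + (Fintype.card P - Fintype.card S : ℝ) ^ 2 / N := by
  have hle : Fintype.card S ≤ Fintype.card P := Fintype.card_le_of_surjective f hf
  have hle' : (Fintype.card S : ℝ) ≤ Fintype.card P := by exact_mod_cast hle
  have hS0 : (0 : ℝ) ≤ Fintype.card S := Nat.cast_nonneg _
  -- The bounds `1 ≤ c ≤ 2 ≤ d + 1` fix the sign inside every absolute value.
  have hc1 : 1 ≤ c := by
    rw [hc, le_div_iff₀ hN0]
    linarith
  have hc2 : c ≤ 2 := by
    rw [hc, div_le_iff₀ hN0]
    linarith
  have hpos (s : S) : (1 : ℝ) ≤ fiberCard f s := by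
    obtain ⟨x, hx⟩ := hf s
    exact_mod_cast Finset.card_pos.2 ⟨x, by simp [hx]⟩
  have hterm (s : S) : |0 - c| + |(fiberCard f s + 1 : ℝ) - c| = fiberCard f s + 1 := by
    rw [abs_of_nonpos (by linarith), abs_of_nonneg (by linarith [hpos s])]
    ring
  have hsum : ∑ s, ((fiberCard f s : ℝ) + 1) = N := by
    rw [hN, Finset.sum_add_distrib, ← sum_fiberCard f]
    simp
  rw [Finset.sum_congr rfl fun s _ => hterm s, hsum, abs_of_nonpos (by linarith),
    Nat.cast_sub hle, hc]
  field_simp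
  rw [hN]
  ring

end StarForest

/-! ### The subgroup generating bipartite graph as a star forest -/

section Graph

variable {G : Type*} [Group G]

/-- The subgroup generated by a pair. -/
def pairClosure (x : G × G) : Subgroup G := Subgroup.closure {x.1, x.2}

@[simp]
lemma sgbGraph_adj_inl_inl (x y : G × G) : ¬(sgbGraph G).Adj (Sum.inl x) (Sum.inl y) := id

@[simp]
lemma sgbGraph_adj_inr_inr (H K : Subgroup G) : ¬(sgbGraph G).Adj (Sum.inr H) (Sum.inr K) := id

@[simp]
lemma sgbGraph_adj_inl_inr (x : G × G) (H : Subgroup G) :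
    (sgbGraph G).Adj (Sum.inl x) (Sum.inr H) ↔ pairClosure x = H := Iff.rfl

@[simp]
lemma sgbGraph_adj_inr_inl (H : Subgroup G) (x : G × G) :
    (sgbGraph G).Adj (Sum.inr H) (Sum.inl x) ↔ pairClosure x = H := Iff.rfl

open Classical in
lemma adjMatrix_sgbGraph : (sgbGraph G).adjMatrix ℝ =
    fromBlocks 0 (incidence (pairClosure (G := G))) (incidence (pairClosure (G := G)))ᵀ 0 := by
  ext (x | H) (y | K) <;> simp [incidence, SimpleGraph.adjMatrix_apply]

variable [Fintype G]

lemma degree_inl (x : G × G) : (sgbGraph G).degree (Sum.inl x) = 1 := by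
  rw [← SimpleGraph.card_neighborFinset_eq_degree, Finset.card_eq_one]
  refine ⟨Sum.inr (pairClosure x), ?_⟩
  ext (y | H) <;> simp [SimpleGraph.mem_neighborFinset, eq_comm]

open Classical in
lemma degree_inr (H : Subgroup G) :
    (sgbGraph G).degree (Sum.inr H) = fiberCard (pairClosure (G := G)) H := by
  rw [← SimpleGraph.card_neighborFinset_eq_degree, fiberCard,
    ← Finset.card_map (Function.Embedding.inl (α := G × G) (β := Subgroup G))]
  congr 1
  ext (y | K) <;> simp [SimpleGraph.mem_neighborFinset]

open Classical in
lemma signlessLapMatrix_sgbGraph : signlessLapMatrix (sgbGraph G) =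
    fromBlocks 1 (incidence (pairClosure (G := G))) (incidence (pairClosure (G := G)))ᵀ
      (diagonal fun H => (fiberCard (pairClosure (G := G)) H : ℝ)) := by
  rw [signlessLapMatrix, adjMatrix_sgbGraph, SimpleGraph.degMatrix]
  ext (x | H) (y | K)
  · by_cases h : x = y <;> simp [one_apply, h, degree_inl]
  · simp
  · simp
  · by_cases h : H = K <;> simp [h, degree_inr]

open Classical in
lemma averageDegree_sgbGraph : averageDegree (sgbGraph G) =
    2 * Fintype.card (G × G) / (Fintype.card (Vertex G) : ℝ) := by
  have h := (sgbGraph G).sum_degrees_eq_twice_card_edges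
  rw [Fintype.sum_sum_type] at h
  simp only [degree_inl, degree_inr, sum_fiberCard, Finset.sum_const, Finset.card_univ,
    smul_eq_mul, mul_one] at h
  have h' : (sgbGraph G).edgeFinset.card = Fintype.card (G × G) := by omega
  rw [averageDegree, h']

/-- Conjugation by the sign matrix of the bipartition fixes `D` and negates `A`. -/
lemma lapSpec_sgbGraph : lapSpec (sgbGraph G) = signlessLapSpec (sgbGraph G) := by
  let ε : Vertex G → ℝ := Sum.elim (fun _ => 1) fun _ => -1
  have hε : diagonal ε * diagonal ε = 1 := by
    rw [diagonal_mul_diagonal, ← diagonal_one]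
    congr 1
    ext (x | H) <;> simp [ε]
  let U : (Matrix (Vertex G) (Vertex G) ℝ)ˣ := ⟨diagonal ε, diagonal ε, hε, hε⟩
  have h : (sgbGraph G).lapMatrix ℝ =
      U.val * signlessLapMatrix (sgbGraph G) * U.val⁻¹ := by
    rw [inv_eq_right_inv (show U.val * diagonal ε = 1 from hε)]
    change _ = diagonal ε * signlessLapMatrix (sgbGraph G) * diagonal ε
    ext (x | H) (y | K)
    all_goals
      rw [mul_diagonal, diagonal_mul]
      simp only [SimpleGraph.lapMatrix, signlessLapMatrix, SimpleGraph.degMatrix, diagonal_apply,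
        SimpleGraph.adjMatrix_apply, Matrix.sub_apply, Matrix.add_apply, ε, Sum.elim_inl,
        Sum.elim_inr]
      split_ifs <;> simp_all
  rw [lapSpec, signlessLapSpec, h, charpoly_units_conj]

open Classical in
lemma energy_sgbGraph (hG : Function.Surjective (pairClosure (G := G))) :
    energy (sgbGraph G) = ∑ H, 2 * √(fiberCard (pairClosure (G := G)) H : ℝ) := by
  have h := charpoly_adjacency (pairClosure (G := G)) (Fintype.card_le_of_surjective _ hG)
  rw [energy, spec, adjMatrix_sgbGraph]
  refine .trans ?_ ((congrArg (fun q : ℝ[X] => (q.roots.map fun x => |x|).sum) h).trans ?_)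
  -- The two sides differ only in instance arguments.
  · congr!
  rw [sum_map_roots_pow_mul_prod (fun x => |x|)]
  simp only [abs_zero, mul_zero, zero_add, abs_neg, abs_of_nonneg (Real.sqrt_nonneg _), two_mul]

lemma signlessLapEnergy_sgbGraph (hG : Function.Surjective (pairClosure (G := G))) :
    signlessLapEnergy (sgbGraph G) = Fintype.card (Vertex G) +
      (Fintype.card (G × G) - Fintype.card (Subgroup G) : ℝ) ^ 2 / Fintype.card (Vertex G) := by
  classical
  have h := charpoly_signless (pairClosure (G := G)) (Fintype.card_le_of_surjective _ hG)
  rw [signlessLapEnergy, signlessLapSpec, signlessLapMatrix_sgbGraph]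
  refine .trans ?_ ((congrArg (fun q : ℝ[X] =>
    (q.roots.map fun x => |x - averageDegree (sgbGraph G)|).sum) h).trans ?_)
  · congr!
  rw [sum_map_roots_pow_mul_prod (fun x => |x - averageDegree (sgbGraph G)|)]
  refine signless_sum_eq _ hG ?_ ?_ averageDegree_sgbGraph
  · rw [Fintype.card_sum, Nat.cast_add]
  · have : Nonempty (Vertex G) := ⟨Sum.inl 1⟩
    exact_mod_cast Fintype.card_pos (α := Vertex G)

lemma lapEnergy_sgbGraph : lapEnergy (sgbGraph G) = signlessLapEnergy (sgbGraph G) := by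
  rw [lapEnergy, signlessLapEnergy, lapSpec_sgbGraph]

/-- For `g ≠ 1`, the pairs `(g, 1)` and `(1, g)` generate the same subgroup. -/
lemma card_subgroup_lt [Nontrivial G] (hG : Function.Surjective (pairClosure (G := G))) :
    Fintype.card (Subgroup G) < Fintype.card (G × G) := by
  obtain ⟨g, hg⟩ := exists_ne (1 : G)
  refine Fintype.card_lt_of_surjective_not_injective _ hG fun hinj => hg ?_
  have h : pairClosure (g, (1 : G)) = pairClosure (1, g) :=
    congrArg Subgroup.closure (Set.pair_comm g 1)
  exact congrArg Prod.fst (hinj h)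

lemma energy_lt_card [Nontrivial G] (hG : Function.Surjective (pairClosure (G := G))) :
    energy (sgbGraph G) < Fintype.card (Vertex G) := by
  classical
  rw [energy_sgbGraph hG, Fintype.card_sum, Nat.cast_add]
  exact sum_two_sqrt_fiberCard_lt _ (card_subgroup_lt hG)

lemma card_lt_signlessLapEnergy [Nontrivial G]
    (hG : Function.Surjective (pairClosure (G := G))) :
    (Fintype.card (Vertex G) : ℝ) < signlessLapEnergy (sgbGraph G) := by
  rw [signlessLapEnergy_sgbGraph hG]
  have h1 : (Fintype.card (Subgroup G) : ℝ) < Fintype.card (G × G) := by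
    exact_mod_cast card_subgroup_lt hG
  have : Nonempty (Vertex G) := ⟨Sum.inl 1⟩
  have h2 : (0 : ℝ) < Fintype.card (Vertex G) := by
    exact_mod_cast Fintype.card_pos (α := Vertex G)
  have h3 : (0 : ℝ) < Fintype.card (G × G) - Fintype.card (Subgroup G) := sub_pos.2 h1
  linarith [div_pos (pow_pos h3 2) h2]

end Graph

/-! ### Two-generation of subgroups of dihedral groups -/

section Dihedral

/-- The inclusion of the rotations in the dihedral group. -/
def rotationHom (n : ℕ) : Multiplicative (ZMod n) →* DihedralGroup n where
  toFun i := DihedralGroup.r i.toAdd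
  map_one' := rfl
  map_mul' _ _ := (DihedralGroup.r_mul_r _ _).symm

/-- Every subgroup of a dihedral group is generated by two elements. -/
lemma pairClosure_dihedralGroup_surjective (n : ℕ) :
    Function.Surjective (pairClosure (G := DihedralGroup n)) := by
  intro H
  -- The rotations in `H` correspond to a subgroup of a cyclic group; `g` generates it.
  obtain ⟨⟨g, hgH⟩, hg⟩ := IsCyclic.exists_generator (α := H.comap (rotationHom n))
  have hrot (b : DihedralGroup n) (i : ZMod n) (hi : DihedralGroup.r i ∈ H) :
      DihedralGroup.r i ∈ pairClosure (rotationHom n g, b) := by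
    obtain ⟨k, hk⟩ := hg ⟨Multiplicative.ofAdd i, hi⟩
    have hk' : g ^ k = Multiplicative.ofAdd i := congrArg Subtype.val hk
    have : rotationHom n g ^ k = DihedralGroup.r i := by
      rw [← map_zpow, hk']
      rfl
    rw [← this]
    exact zpow_mem (Subgroup.subset_closure (Set.mem_insert _ _)) k
  by_cases hs : ∃ j, DihedralGroup.sr j ∈ H
  · obtain ⟨j, hj⟩ := hs
    refine ⟨(rotationHom n g, DihedralGroup.sr j), le_antisymm ?_ ?_⟩
    · refine (Subgroup.closure_le _).2 ?_
      rintro x (rfl | rfl)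
      exacts [hgH, hj]
    · rintro (i | i) hi
      · exact hrot _ i hi
      -- Each reflection in `H` is the fixed one times a rotation in `H`.
      · have h1 : DihedralGroup.sr j * DihedralGroup.r (i - j) = DihedralGroup.sr i := by simp
        have h2 : DihedralGroup.r (i - j) ∈ H := by
          simpa using H.mul_mem hj hi
        rw [← h1]
        exact mul_mem (Subgroup.subset_closure (Set.mem_insert_of_mem _ rfl)) (hrot _ _ h2)
  · refine ⟨(rotationHom n g, 1), le_antisymm ?_ ?_⟩
    · refine (Subgroup.closure_le _).2 ?_
      rintro x (rfl | rfl)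
      exacts [hgH, H.one_mem]
    · rintro (i | i) hi
      · exact hrot _ i hi
      · exact absurd ⟨i, hi⟩ hs

end Dihedral

end SGB

theorem mainTheorem11 (p : ℕ) [Fact p.Prime] (n : ℕ) [NeZero n] (hn : n = p ∨ n = p ^ 2) :
    SGB.energy (SGB.sgbGraph (DihedralGroup n)) <
        (Fintype.card (SGB.Vertex (DihedralGroup n)) : ℝ) ∧
      (Fintype.card (SGB.Vertex (DihedralGroup n)) : ℝ) <
        SGB.lapEnergy (SGB.sgbGraph (DihedralGroup n)) ∧
      SGB.energy (SGB.sgbGraph (DihedralGroup n)) <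
        SGB.lapEnergy (SGB.sgbGraph (DihedralGroup n)) ∧
      SGB.lapEnergy (SGB.sgbGraph (DihedralGroup n)) =
        SGB.signlessLapEnergy (SGB.sgbGraph (DihedralGroup n)) := by
  have hG := SGB.pairClosure_dihedralGroup_surjective n
  have h1 := SGB.energy_lt_card hG
  have h2 := SGB.card_lt_signlessLapEnergy hG
  rw [SGB.lapEnergy_sgbGraph]
  exact ⟨h1, h2, h1.trans h2, rfl⟩
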